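/- Let $q\in(0,1)$ and let $(\omega_{i,j})_{i,j\ge 1}$ be independent random variables with $\mathbb{P}(\omega_{i,j}=k)=(1-q^2)q^{2k}$ for $k=0,1,2,\ldots$. For integers $n,m\ge 1$ let $$G_{n,m}=\max_{\pi}\sum_{(i,j)\in\pi}\omega_{i,j},$$ where the maximum is over all up-right paths $\pi$ from $(1,1)$ to $(n,m)$, i.e. lattice paths each of whose steps increases exactly one coordinate by $1$. For an integer $m\ge1$ and $\lambda_1,\lambda_2>-1$, the Jacobi unitary ensemble (JUE) with $m$ particles and parameters $\lambda_1,\lambda_2$ is the probability measure on $[0,1]^m$ with density $$\frac{1}{Z_m(\lambda_1,\lambda_2)}\prod_{1\le i<j\le m}(x_j-x_i)^2\prod_{j=1}^m x_j^{\lambda_1}(1-x_j)^{\lambda_2},$$ where $Z_m(\lambda_1,\lambda_2)$ is the normalization constant, and $x^{(m)}_{\max}(\lambda_1,\lambda_2)=\max_{1\le j\le m}x_j$ denotes its largest particle (eigenvalue). Then for all integers $n\ge m\ge 1$ and every integer $\ell\ge 0$, $$\mathbb{P}(G_{n,m}\le \ell)=\mathbb{P}\big(x^{(m)}_{\max}(n-m,\ell)\le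 1-q^2\big).$$ -/

import Mathlib

/-! ### Last passage percolation on the positive quadrant -/

/-- An up-right step between two sites of the positive quadrant: exactly one coordinate
increases, by one. -/
def IsUpRightStep (a b : ℕ+ × ℕ+) : Prop :=
  b = (a.1 + 1, a.2) ∨ b = (a.1, a.2 + 1)

/-- `p` is (the list of the successively visited sites of) an up-right path from `(1,1)` to
`(n,m)`. -/
def IsUpRightPath (n m : ℕ+) (p : List (ℕ+ × ℕ+)) : Prop :=
  p.IsChain IsUpRightStep ∧ p.head? = some (1, 1) ∧ p.getLast? = some (n, m)

/-- The set of total weights of the up-right paths from `(1,1)` to `(n,m)`, in the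
environment `w`. -/
def passageTimes (w : ℕ+ × ℕ+ → ℕ) (n m : ℕ+) : Set ℕ :=
  {t | ∃ p : List (ℕ+ × ℕ+), IsUpRightPath n m p ∧ t = (p.map w).sum}

/-- The last passage time: the maximum of the total weights of the up-right paths from `(1,1)`
to `(n,m)` (it is attained, see `isGreatest_lastPassageTime`). -/
noncomputable def lastPassageTime (w : ℕ+ × ℕ+ → ℕ) (n m : ℕ+) : ℕ :=
  sSup (passageTimes w n m)

theorem exists_isUpRightPath (n m : ℕ+) : ∃ p, IsUpRightPath n m p := by
  have key : ∀ (n m n' m' : ℕ+) (p : List (ℕ+ × ℕ+)), IsUpRightPath n m p →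
      IsUpRightStep (n, m) (n', m') → IsUpRightPath n' m' (p ++ [(n', m')]) := by
    rintro n m n' m' p ⟨h1, h2, h3⟩ hs
    refine ⟨?_, by simp [h2], by simp⟩
    rw [List.isChain_append]
    refine ⟨h1, List.isChain_singleton _, ?_⟩
    intro x hx y hy
    rw [h3] at hx
    simp only [Option.mem_def, Option.some.injEq] at hx
    simp only [List.head?_cons, Option.mem_def, Option.some.injEq] at hy
    subst hx; subst hy; exact hs
  induction n using PNat.recOn with
  | one =>
    induction m using PNat.recOn with
    | one => exact ⟨[(1, 1)], List.isChain_singleton _, rfl, rfl⟩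
    | succ m ih =>
      obtain ⟨p, hp⟩ := ih
      exact ⟨_, key _ _ _ _ p hp (Or.inr rfl)⟩
  | succ n ih =>
    obtain ⟨p, hp⟩ := ih
    exact ⟨_, key _ _ _ _ p hp (Or.inl rfl)⟩

theorem isGreatest_lastPassageTime (w : ℕ+ × ℕ+ → ℕ) (n m : ℕ+) :
    IsGreatest (passageTimes w n m) (lastPassageTime w n m) := by
  have hne : (passageTimes w n m).Nonempty := by
    obtain ⟨p, hp⟩ := exists_isUpRightPath n m
    exact ⟨_, p, hp, rfl⟩
  have hbd : BddAbove (passageTimes w n m) := by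
    refine ⟨∑ a ∈ Finset.Icc (1, 1) (n, m), w a, ?_⟩
    rintro t ⟨p, ⟨h1, h2, h3⟩, rfl⟩
    have hlt : ∀ a b : ℕ+ × ℕ+, IsUpRightStep a b → a < b := by
      rintro ⟨a, a'⟩ b (rfl | rfl)
      · exact Prod.mk_lt_mk.2 (Or.inl ⟨PNat.lt_add_right a 1, le_rfl⟩)
      · exact Prod.mk_lt_mk.2 (Or.inr ⟨le_rfl, PNat.lt_add_right a' 1⟩)
    have hpw : p.Pairwise (· < ·) := List.isChain_iff_pairwise.1 (h1.imp hlt)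
    have hnd : p.Nodup := hpw.imp (fun h => h.ne)
    have hsub : p.toFinset ⊆ Finset.Icc (1, 1) (n, m) := by
      intro a ha
      rw [List.mem_toFinset] at ha
      obtain ⟨l, hl⟩ := List.getLast?_eq_some_iff.1 h3
      refine Finset.mem_Icc.2 ⟨⟨one_le, one_le⟩, ?_⟩
      rw [hl] at ha hpw
      rcases List.mem_append.1 ha with ha | ha
      · exact ((List.pairwise_append.1 hpw).2.2 a ha _ (List.mem_singleton.2 rfl)).le
      · exact (List.mem_singleton.1 ha).le
    rw [← List.sum_toFinset w hnd]
    exact Finset.sum_le_sum_of_subset hsub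
  exact ⟨Nat.sSup_mem hne hbd, fun t ht => le_csSup hbd ht⟩

/-! ### The Jacobi unitary ensemble -/

/-- The unnormalized density of the Jacobi unitary ensemble with `m` particles and parameters
`a`, `b`, on the cube `[0,1]^m`. -/
noncomputable def jueWeight (m : ℕ) (a b : ℝ) (x : Fin m → ℝ) : ℝ :=
  (∏ i : Fin m, ∏ j ∈ Finset.Ioi i, (x j - x i) ^ 2) * ∏ j : Fin m, x j ^ a * (1 - x j) ^ b

/-- The normalization constant (a Selberg integral). -/
noncomputable def jueZ (m : ℕ) (a b : ℝ) : ℝ :=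
  ∫ x in Set.Icc (0 : Fin m → ℝ) 1, jueWeight m a b x

/-- The Jacobi unitary ensemble with `m` particles and parameters `a`, `b`, as the joint law of
its particles: the measure on `ℝ^m` with density `jueWeight m a b / jueZ m a b` on `[0,1]^m`.
For `a, b > -1` it is a probability measure, see `isProbabilityMeasure_jueMeasure`. -/
noncomputable def jueMeasure (m : ℕ) (a b : ℝ) : MeasureTheory.Measure (Fin m → ℝ) :=
  (MeasureTheory.volume.restrict (Set.Icc (0 : Fin m → ℝ) 1)).withDensity
    (fun x => ENNReal.ofReal (jueWeight m a b x / jueZ m a b))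

/-- The largest particle of a configuration. -/
noncomputable def largestParticle {m : ℕ} (x : Fin m → ℝ) : ℝ := ⨆ j, x j

theorem measurable_jueWeight (m : ℕ) (a b : ℝ) : Measurable (jueWeight m a b) := by
  unfold jueWeight
  fun_prop

theorem jueWeight_nonneg {m : ℕ} {a b : ℝ} {x : Fin m → ℝ}
    (hx : x ∈ Set.Icc (0 : Fin m → ℝ) 1) : 0 ≤ jueWeight m a b x := by
  refine mul_nonneg (Finset.prod_nonneg fun i _ => Finset.prod_nonneg fun j _ => sq_nonneg _)
    (Finset.prod_nonneg fun j _ => mul_nonneg (Real.rpow_nonneg (hx.1 j) _)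
      (Real.rpow_nonneg (sub_nonneg.2 (hx.2 j)) _))

theorem integrableOn_jueWeight (m : ℕ) {a b : ℝ} (ha : -1 < a) (hb : -1 < b) :
    MeasureTheory.IntegrableOn (jueWeight m a b) (Set.Icc (0 : Fin m → ℝ) 1) := by
  have h1 : MeasureTheory.IntegrableOn (fun t : ℝ => t ^ a * (1 - t) ^ b) (Set.Icc 0 1) := by
    have hc := Complex.betaIntegral_convergent (u := (a + 1 : ℝ)) (v := (b + 1 : ℝ))
      (by simpa using by linarith) (by simpa using by linarith)
    rw [intervalIntegrable_iff_integrableOn_Ioo_of_le zero_le_one] at hc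
    rw [integrableOn_Icc_iff_integrableOn_Ioo]
    refine MeasureTheory.IntegrableOn.congr_fun (MeasureTheory.Integrable.norm hc) ?_
      measurableSet_Ioo
    intro t ht
    have ht' : 0 < 1 - t := sub_pos.2 ht.2
    have e : (1 : ℂ) - (t : ℂ) = ((1 - t : ℝ) : ℂ) := by push_cast; rfl
    simp only [norm_mul, e]
    rw [Complex.norm_cpow_eq_rpow_re_of_pos ht.1, Complex.norm_cpow_eq_rpow_re_of_pos ht']
    simp
  have h2 : MeasureTheory.IntegrableOn
      (fun x : Fin m → ℝ => ∏ j : Fin m, x j ^ a * (1 - x j) ^ b)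
      (Set.Icc (0 : Fin m → ℝ) 1) := by
    have h3 := MeasureTheory.Integrable.fintype_prod
      (μ := fun _ : Fin m => MeasureTheory.volume.restrict (Set.Icc (0 : ℝ) 1))
      (f := fun _ t => t ^ a * (1 - t) ^ b) (fun _ => h1)
    rw [← MeasureTheory.Measure.restrict_pi_pi, Set.pi_univ_Icc] at h3
    exact h3
  refine MeasureTheory.IntegrableOn.continuousOn_mul (K := Set.Icc (0 : Fin m → ℝ) 1) ?_ h2
    isCompact_Icc
  fun_prop

theorem jueZ_pos (m : ℕ) {a b : ℝ} (ha : -1 < a) (hb : -1 < b) : 0 < jueZ m a b := by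
  rw [jueZ, MeasureTheory.setIntegral_pos_iff_support_of_nonneg_ae
    ((MeasureTheory.ae_restrict_mem measurableSet_Icc).mono fun x hx => jueWeight_nonneg hx)
    (integrableOn_jueWeight m ha hb)]
  let U : Set (Fin m → ℝ) := {x | (∀ j, 0 < x j) ∧ (∀ j, x j < 1) ∧ ∀ i j, i < j → x i < x j}
  have hU : IsOpen U := by
    simp only [U, Set.ofPred_and, Set.ofPred_forall]
    refine (isOpen_iInter_of_finite fun j => ?_).inter
      ((isOpen_iInter_of_finite fun j => ?_).inter
        (isOpen_iInter_of_finite fun i => isOpen_iInter_of_finite fun j =>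
          isOpen_iInter_of_finite fun _ => ?_))
    · exact isOpen_lt (by fun_prop) (by fun_prop)
    · exact isOpen_lt (by fun_prop) (by fun_prop)
    · exact isOpen_lt (by fun_prop) (by fun_prop)
  have hne : U.Nonempty := by
    refine ⟨fun j => ((j : ℝ) + 1) / ((m : ℝ) + 1), fun j => by positivity, fun j => ?_,
      fun i j hij => ?_⟩
    · rw [div_lt_one (by positivity)]
      have : ((j : ℕ) : ℝ) < m := by exact_mod_cast j.2
      linarith
    · have : ((i : ℕ) : ℝ) < (j : ℕ) := by exact_mod_cast hij
      exact div_lt_div_of_pos_right (by linarith) (by positivity)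
  refine (hU.measure_pos MeasureTheory.volume hne).trans_le (MeasureTheory.measure_mono ?_)
  rintro x ⟨h0, h1, h2⟩
  refine ⟨?_, fun j => (h0 j).le, fun j => (h1 j).le⟩
  refine (mul_pos (Finset.prod_pos fun i _ => Finset.prod_pos fun j hj => ?_)
    (Finset.prod_pos fun j _ => ?_)).ne'
  · have := h2 i j (Finset.mem_Ioi.1 hj)
    exact pow_pos (sub_pos.2 this) 2
  · exact mul_pos (Real.rpow_pos_of_pos (h0 j) _) (Real.rpow_pos_of_pos (sub_pos.2 (h1 j)) _)

theorem isProbabilityMeasure_jueMeasure (m : ℕ) {a b : ℝ} (ha : -1 < a) (hb : -1 < b) :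
    MeasureTheory.IsProbabilityMeasure (jueMeasure m a b) := by
  have hZ := jueZ_pos m ha hb
  refine ⟨?_⟩
  rw [jueMeasure, MeasureTheory.withDensity_apply _ MeasurableSet.univ,
    MeasureTheory.Measure.restrict_univ,
    ← MeasureTheory.ofReal_integral_eq_lintegral_ofReal
      ((integrableOn_jueWeight m ha hb).div_const _)
      ((MeasureTheory.ae_restrict_mem measurableSet_Icc).mono fun x hx =>
        div_nonneg (jueWeight_nonneg hx) hZ.le),
    MeasureTheory.integral_div, ← jueZ, div_self hZ.ne', ENNReal.ofReal_one]

/-!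
Put `t = q ^ 2`, `m = M + 1` and `n = a + m`. Both sides are shown to be the same determinant.

**Last passage percolation.** Visit the sites column by column and keep the increasing vector of
last passage times to the ends of the `m` rows. Visiting a site makes one coordinate jump by a
geometric variable and pushes the later coordinates up (`pushJump`). The probability that the last
coordinate ends up at most `l` solves a backward equation, and `backwardDet` solves it explicitly:
its rows are averages of the terminal functions over the remaining jumps, and the discrete
difference of a row is the preceding row. Because of the latter, pushing a coordinate is a row
operation and does not change the determinant (`backwardDet_pushJump_one`), while a geometric jump
is a linear recursion in a single row (`backwardDet_recursion`). At the end the determinant is an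
indicator function (`backwardDet_terminal`). Hence the determinants along the chain form a
martingale, and the probability is the determinant at time zero (`measure_lastPassageTime_le`).

**The Jacobi ensemble.** By Andréief's identity (`integral_det_mul_det`) the distribution function
of the largest particle at `ε` is the quotient of the Hankel determinants of
`∫₀^ε x ^ (i + j + a) (1 - x) ^ l dx` for `ε` and for `1` (`jueMeasure_largestParticle_le`).

**The link.** At time zero, `backwardDet` has entries `Λ (pᵢ qⱼ)`, where `Λ` extracts a coefficient
of a power series and the `pᵢ`, `qⱼ` are bases of the polynomials of degree at most `M`. Changing
bases by matrices of constant determinant, one may take `pᵢ = X ^ i (1 - t X) ^ (M - i)` and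
`qⱼ = (1 - X) ^ j` (`backwardDet_const_zero`). In the Hankel determinant for `ε = 1 - t` one may
take `x ^ i (1 - x) ^ (M - i)` and `(ε - x) ^ (M - j)`. Then the substitution `x = ε y` and the
expansion of `(1 - ε y) ^ (l + M - i) = (t y + (1 - y)) ^ (l + M - i)` into beta integrals show
that the two matrices agree entry by entry, up to factors which depend on only the row or only the
column (`integral_pow_mul_one_sub_pow_mul_sub_pow`). The powers of `1 - t` among these factors
multiply to the power of `1 - t` in `backwardDet_const_zero`, so that the two determinants differ
by a factor free of `t`. It is found by setting `t = 0`, where `backwardDet` is `1`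
(`backwardDet_mul_jacobiHankel_one`).
-/

/-! ### The determinant solving the backward equations -/

section Kernel

open PowerSeries

/-- The geometric series `1 + t X + t ^ 2 X ^ 2 + ⋯ = (1 - t X)⁻¹`. -/
noncomputable def geomSeries (t : ℝ) : ℝ⟦X⟧ := PowerSeries.mk fun k => t ^ k

theorem geomSeries_eq (t : ℝ) : geomSeries t = 1 + C t * X * geomSeries t := by
  ext k
  rw [mul_assoc]
  rcases k with _ | k
  · simp [geomSeries]
  · rw [map_add, coeff_C_mul, coeff_succ_X_mul]
    simp [geomSeries, pow_succ', coeff_one]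

theorem one_sub_mul_geomSeries (t : ℝ) : (1 - C t * X) * geomSeries t = 1 := by
  rw [sub_mul, one_mul, sub_eq_iff_eq_add]
  exact geomSeries_eq t

theorem one_sub_X_mul_geomSeries : (1 - X) * geomSeries 1 = 1 := by
  simpa using one_sub_mul_geomSeries 1

/-- The generating function `(1 - t) (1 - t X)⁻¹` of a geometric variable. -/
noncomputable def geomGF (t : ℝ) : ℝ⟦X⟧ := C (1 - t) * geomSeries t

theorem geomGF_eq (t : ℝ) : geomGF t = C (1 - t) + C t * X * geomGF t := by
  unfold geomGF
  linear_combination C (1 - t) * geomSeries_eq t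

/-- The power series whose coefficient of `X ^ (l + M - x)` is the `(b, j)` entry of the
determinant `backwardDet`, when the `b`-th coordinate of the state is `x` and still has `r` jumps
ahead of it. Up to powers of `X` it is `(1 - X) ^ (j - b - 1)`, an iterated difference or sum of an
indicator function, averaged over `r` geometric jumps; the powers of `X` and the factor
`geomSeries 1 ^ (M + 1)` avoid negative exponents. -/
noncomputable def kernelSeries (M : ℕ) (t : ℝ) (b j r : ℕ) : ℝ⟦X⟧ :=
  X ^ b * (1 - X) ^ (M - b) * (X ^ (M - j) * (1 - X) ^ j) * geomSeries 1 ^ (M + 1) * geomGF t ^ r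

/-- The `(b, j)` entry of `backwardDet`. Multiplying by `X ^ x` instead of lowering the index of
the coefficient makes the entry vanish for `x > l + M`. -/
noncomputable def kernelEntry (M l : ℕ) (t : ℝ) (b j r x : ℕ) : ℝ :=
  coeff (l + M) (X ^ x * kernelSeries M t b j r)

theorem kernelEntry_of_lt {M l : ℕ} {t : ℝ} {b j r x : ℕ} (h : l + M < x) :
    kernelEntry M l t b j r x = 0 := by
  rw [kernelEntry, coeff_X_pow_mul', if_neg (not_le.2 h)]

theorem kernelEntry_succ_jump (M l : ℕ) (t : ℝ) (b j r x : ℕ) :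
    kernelEntry M l t b j (r + 1) x =
      (1 - t) * kernelEntry M l t b j r x + t * kernelEntry M l t b j (r + 1) (x + 1) := by
  unfold kernelEntry
  rw [← coeff_C_mul, ← coeff_C_mul, ← map_add]
  congr 1
  unfold kernelSeries
  linear_combination (X ^ x * (X ^ b * (1 - X) ^ (M - b) * (X ^ (M - j) * (1 - X) ^ j) *
    geomSeries 1 ^ (M + 1) * geomGF t ^ r)) * geomGF_eq t

/-- The boundary condition: the difference of row `b + 1` is row `b`. -/
theorem kernelEntry_succ_row (M l : ℕ) (t : ℝ) {b : ℕ} (hb : b < M) (j r x : ℕ) :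
    kernelEntry M l t (b + 1) j r x =
      kernelEntry M l t (b + 1) j r (x + 1) + kernelEntry M l t b j r (x + 1) := by
  unfold kernelEntry
  rw [← map_add]
  congr 1
  unfold kernelSeries
  obtain ⟨d, rfl⟩ := Nat.exists_eq_add_of_lt hb
  rw [show b + d + 1 - (b + 1) = d by omega, show b + d + 1 - b = d + 1 by omega]
  ring

/-- The determinant which gives the probability that the last passage time is at most `l`, when
the current state is `x` and the coordinate `b` is still to be updated `r b` times. -/
noncomputable def backwardDet (M l : ℕ) (t : ℝ) (r x : Fin (M + 1) → ℕ) : ℝ :=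
  (Matrix.of fun b j : Fin (M + 1) => kernelEntry M l t b j (r b) (x b)).det

/-- The update of a state at coordinate `i`: this coordinate jumps by `k` and pushes the later
ones. -/
def pushJump {M : ℕ} (i : Fin (M + 1)) (x : Fin (M + 1) → ℕ) (k : ℕ) : Fin (M + 1) → ℕ :=
  fun b => if b < i then x b else max (x b) (x i + k)

theorem pushJump_monotone {M : ℕ} {i : Fin (M + 1)} {x : Fin (M + 1) → ℕ} (hx : Monotone x)
    (k : ℕ) : Monotone (pushJump i x k) := by
  intro b c hbc
  have := hx hbc
  unfold pushJump
  split_ifs with h1 h2 h2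
  · exact this
  · exact le_max_of_le_left this
  · exact absurd (hbc.trans_lt h2) h1
  · exact max_le_max_right _ this

theorem pushJump_zero {M : ℕ} {i : Fin (M + 1)} {x : Fin (M + 1) → ℕ} (hx : Monotone x) :
    pushJump i x 0 = x := by
  ext b
  unfold pushJump
  split_ifs with h
  · rfl
  · simpa using hx (not_lt.1 h)

theorem pushJump_pushJump {M : ℕ} (i : Fin (M + 1)) (x : Fin (M + 1) → ℕ) (k k' : ℕ) :
    pushJump i (pushJump i x k) k' = pushJump i x (k + k') := by
  ext b
  by_cases h : b < i
  · simp [pushJump, h]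
  · simp only [pushJump, h, lt_irrefl, if_false]
    omega

theorem backwardDet_of_lt {M l : ℕ} {t : ℝ} {r x : Fin (M + 1) → ℕ} {i : Fin (M + 1)}
    (h : l + M < x i) : backwardDet M l t r x = 0 :=
  Matrix.det_eq_zero_of_row_eq_zero i fun _ => kernelEntry_of_lt h

/-- Pushing the coordinates above `i` does not change the determinant: by the boundary condition,
moving them amounts to adding to some rows a multiple of the preceding row. -/
theorem backwardDet_pushJump_one {M l : ℕ} {t : ℝ} {r x : Fin (M + 1) → ℕ} {i : Fin (M + 1)}
    (hx : Monotone x) (hr : ∀ b, i ≤ b → r b = r i) :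
    backwardDet M l t r (pushJump i x 1) =
      backwardDet M l t r (Function.update x i (x i + 1)) := by
  unfold backwardDet
  refine Matrix.det_eq_of_forall_row_eq_smul_add_pred
    (fun b : Fin M => if i ≤ b.castSucc ∧ x b.succ = x i then -1 else 0) ?_ ?_
  · intro j
    simp only [Matrix.of_apply]
    congr 1
    rcases eq_or_ne i 0 with rfl | hi
    · simp [pushJump]
    · rw [Function.update_of_ne hi.symm, pushJump, if_pos (Fin.pos_of_ne_zero hi)]
  · intro b j
    simp only [Matrix.of_apply]
    split_ifs with h
    · obtain ⟨h1, h2⟩ := h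
      have h3 : i < b.succ := h1.trans_lt Fin.castSucc_lt_succ
      have h4 : x b.castSucc = x i :=
        le_antisymm (h2 ▸ hx Fin.castSucc_lt_succ.le) (hx h1)
      rw [Function.update_of_ne h3.ne', hr _ h3.le, hr _ h1, pushJump, pushJump,
        if_neg h3.not_gt, if_neg h1.not_gt, h2, h4, max_eq_right (Nat.le_succ _)]
      have := kernelEntry_succ_row M l t b.2 j (r i) (x i)
      simp only [Fin.val_succ, Fin.val_castSucc]
      linarith
    · rw [zero_mul, add_zero]
      congr 1
      rcases lt_trichotomy b.succ i with h3 | h3 | h3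
      · rw [Function.update_of_ne h3.ne, pushJump, if_pos h3]
      · subst h3
        simp [pushJump]
      · rw [Function.update_of_ne h3.ne', pushJump, if_neg h3.not_gt]
        have h1 : i ≤ b.castSucc := Fin.le_castSucc_iff.2 h3
        have h2 : x b.succ ≠ x i := fun h2 => h ⟨h1, h2⟩
        have := hx h3.le
        omega

theorem backwardDet_recursion {M l : ℕ} {t : ℝ} {r x : Fin (M + 1) → ℕ} {i : Fin (M + 1)} {s : ℕ}
    (hx : Monotone x) (hs : r i = s + 1) (hr : ∀ b, i ≤ b → r b = r i) :
    backwardDet M l t r x = (1 - t) * backwardDet M l t (Function.update r i s) x +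
      t * backwardDet M l t r (pushJump i x 1) := by
  rw [backwardDet_pushJump_one hx hr]
  set A : Matrix (Fin (M + 1)) (Fin (M + 1)) ℝ :=
    Matrix.of fun b j : Fin (M + 1) => kernelEntry M l t b j (r b) (x b) with hA
  have h1 : backwardDet M l t (Function.update r i s) x =
      (A.updateRow i fun j => kernelEntry M l t i j s (x i)).det := by
    unfold backwardDet
    congr 1
    ext b j
    rcases eq_or_ne b i with rfl | hb
    · simp
    · simp [hb, hA]
  have h2 : backwardDet M l t r (Function.update x i (x i + 1)) =
      (A.updateRow i fun j => kernelEntry M l t i j (s + 1) (x i + 1)).det := by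
    unfold backwardDet
    congr 1
    ext b j
    rcases eq_or_ne b i with rfl | hb
    · simp [hs]
    · simp [hb, hA]
  have h3 : A = A.updateRow i ((1 - t) • (fun j : Fin (M + 1) => kernelEntry M l t i j s (x i)) +
      t • fun j : Fin (M + 1) => kernelEntry M l t i j (s + 1) (x i + 1)) := by
    ext b j
    rcases eq_or_ne b i with rfl | hb
    · simpa [hA, hs] using kernelEntry_succ_jump M l t b j s (x b)
    · simp [hb]
  rw [h1, h2, ← Matrix.det_updateRow_smul, ← Matrix.det_updateRow_smul,
    ← Matrix.det_updateRow_add, ← h3]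
  rfl

/-- When no update is left, the determinant is the indicator function of the event that the last
coordinate is at most `l`. -/
theorem backwardDet_terminal (M l : ℕ) (t : ℝ) {x : Fin (M + 1) → ℕ} (hx : Monotone x) :
    backwardDet M l t 0 x = if x (Fin.last M) ≤ l then 1 else 0 := by
  -- With `(1 - X) ^ (M - b + j)` cancelled against `(1 - X)⁻¹ ^ (M + 1)`.
  have key : ∀ b j d : ℕ, b ≤ M → j ≤ M → M - b + j + d = M + 1 → ∀ y,
      kernelEntry M l t b j 0 y =
        coeff (l + M) (X ^ (y + b + (M - j)) * geomSeries 1 ^ d) := by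
    intro b j d hb hj hd y
    unfold kernelEntry kernelSeries
    congr 1
    have h1 : ((1 - X) ^ (M - b) * (1 - X) ^ j) * geomSeries 1 ^ (M - b + j) = 1 := by
      rw [← pow_add, ← mul_pow, one_sub_X_mul_geomSeries, one_pow]
    rw [← hd, pow_add _ _ d]
    linear_combination (X ^ (y + b + (M - j)) * geomSeries 1 ^ d) * h1
  split_ifs with h
  · have hxl : ∀ b, x b ≤ l := fun b => (hx (Fin.le_last b)).trans h
    unfold backwardDet
    rw [Matrix.det_of_isLowerTriangular]
    · refine Finset.prod_eq_one fun b _ => ?_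
      have hb : (b : ℕ) ≤ M := Nat.lt_succ_iff.1 b.2
      rw [Matrix.of_apply, Pi.zero_apply, key b b 1 hb hb (by omega), coeff_X_pow_mul', if_pos]
      · simp [geomSeries]
      · have := hxl b
        omega
    · intro b j hbj
      have hbj : (b : ℕ) < j := hbj
      have hj : (j : ℕ) ≤ M := Nat.lt_succ_iff.1 j.2
      -- Here the negative powers of `1 - X` cancel, and a polynomial of low degree is left.
      obtain ⟨e, he⟩ : ∃ e, (j : ℕ) = b + 1 + e := Nat.exists_eq_add_of_le hbj
      have h1 : ((1 - X) ^ (M + 1)) * geomSeries 1 ^ (M + 1) = 1 := by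
        rw [← mul_pow, one_sub_X_mul_geomSeries, one_pow]
      have h2 : (X ^ x b * kernelSeries M t b j 0 : ℝ⟦X⟧) =
          ((Polynomial.X ^ (x b + b + (M - j)) * (1 - Polynomial.X) ^ e : Polynomial ℝ) :
            ℝ⟦X⟧) := by
        unfold kernelSeries
        push_cast
        rw [show (j : ℕ) = (b : ℕ) + 1 + e from he]
        have h3 : (1 - X : ℝ⟦X⟧) ^ (M - b) * (1 - X) ^ ((b : ℕ) + 1 + e) =
            (1 - X) ^ (M + 1) * (1 - X) ^ e := by
          rw [← pow_add, ← pow_add]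
          congr 1
          omega
        linear_combination (X ^ (x b + b + (M - (b + 1 + e))) * geomSeries 1 ^ (M + 1)) * h3 +
          (X ^ (x b + b + (M - (b + 1 + e))) * (1 - X) ^ e) * h1
      rw [Matrix.of_apply, Pi.zero_apply, kernelEntry, h2, Polynomial.coeff_coe]
      refine Polynomial.coeff_eq_zero_of_natDegree_lt ?_
      have h4 : (Polynomial.X ^ (x b + b + (M - j)) * (1 - Polynomial.X) ^ e :
          Polynomial ℝ).natDegree ≤ x b + b + (M - j) + e := by
        have : (1 - Polynomial.X : Polynomial ℝ).natDegree ≤ 1 := by compute_degree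
        refine Polynomial.natDegree_mul_le.trans (add_le_add (by simp) ?_)
        simpa using Polynomial.natDegree_pow_le_of_le e this
      have := hxl b
      omega
  · refine Matrix.det_eq_zero_of_row_eq_zero (Fin.last M) fun j => ?_
    have hj : (j : ℕ) ≤ M := Nat.lt_succ_iff.1 j.2
    rw [Matrix.of_apply, Pi.zero_apply, Fin.val_last, key M j (M + 1 - j) le_rfl hj (by omega),
      coeff_X_pow_mul', if_neg (by omega)]

end Kernel

/-! ### The recursion for last passage times -/

section Recursion

/-- The last passage time from `(1,1)` to `(a,b)` as given by its recursion, extended by zero to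
the coordinate axes. -/
def latticeTime (w : ℕ+ × ℕ+ → ℕ) : ℕ → ℕ → ℕ
  | 0, _ => 0
  | _ + 1, 0 => 0
  | a + 1, b + 1 =>
    max (latticeTime w a (b + 1)) (latticeTime w (a + 1) b) + w (a.succPNat, b.succPNat)

theorem latticeTime_zero_right (w : ℕ+ × ℕ+ → ℕ) (a : ℕ) : latticeTime w a 0 = 0 := by
  cases a <;> simp [latticeTime]

theorem latticeTime_succ_succ (w : ℕ+ × ℕ+ → ℕ) (a b : ℕ) : latticeTime w (a + 1) (b + 1) =
    max (latticeTime w a (b + 1)) (latticeTime w (a + 1) b) + w (a.succPNat, b.succPNat) := by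
  rw [latticeTime]

theorem latticeTime_le_succ_right (w : ℕ+ × ℕ+ → ℕ) (a b : ℕ) :
    latticeTime w (a + 1) b ≤ latticeTime w (a + 1) (b + 1) := by
  rw [latticeTime_succ_succ]
  omega

theorem latticeTime_add_le_of_step (w : ℕ+ × ℕ+ → ℕ) {y x : ℕ+ × ℕ+} (h : IsUpRightStep y x) :
    latticeTime w y.1 y.2 + w x ≤ latticeTime w x.1 x.2 := by
  obtain ⟨c, d⟩ := y
  rw [← PNat.succPNat_natPred c, ← PNat.succPNat_natPred d] at *
  generalize c.natPred = c at *
  generalize d.natPred = d at *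
  rcases h with rfl | rfl
  · have := latticeTime_succ_succ w (c + 1) d
    simp only [PNat.add_coe, Nat.succPNat_coe, PNat.one_coe, Nat.succ_eq_add_one]
    rw [this]
    exact Nat.add_le_add (le_max_left _ _) le_rfl
  · have := latticeTime_succ_succ w c (d + 1)
    simp only [PNat.add_coe, Nat.succPNat_coe, PNat.one_coe, Nat.succ_eq_add_one]
    rw [this]
    exact Nat.add_le_add (le_max_right _ _) le_rfl

theorem IsUpRightPath.concat {n m n' m' : ℕ+} {p : List (ℕ+ × ℕ+)} (hp : IsUpRightPath n m p)
    (hs : IsUpRightStep (n, m) (n', m')) : IsUpRightPath n' m' (p ++ [(n', m')]) := by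
  obtain ⟨h1, h2, h3⟩ := hp
  refine ⟨?_, by simp [h2], by simp⟩
  rw [List.isChain_append]
  refine ⟨h1, List.isChain_singleton _, ?_⟩
  simp only [h3, Option.mem_def, Option.some.injEq, List.head?_cons]
  rintro x rfl y rfl
  exact hs

theorem sum_le_latticeTime (w : ℕ+ × ℕ+ → ℕ) (p : List (ℕ+ × ℕ+)) :
    ∀ n m : ℕ+, IsUpRightPath n m p → (p.map w).sum ≤ latticeTime w n m := by
  induction p using List.reverseRecOn with
  | nil => rintro n m ⟨-, h, -⟩; simp at h
  | append_singleton p x ih =>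
    rintro n m ⟨h1, h2, h3⟩
    obtain rfl : x = (n, m) := by simpa using h3
    rw [List.isChain_append] at h1
    rcases p.eq_nil_or_concat with rfl | ⟨p', y, rfl⟩
    · have h4 : (n, m) = ((1 : ℕ+), (1 : ℕ+)) := by simpa using h2
      obtain ⟨rfl, rfl⟩ := Prod.mk.inj h4
      have := latticeTime_succ_succ w 0 0
      simp only [List.nil_append, List.map_cons, List.map_nil, List.sum_singleton,
        PNat.one_coe]
      rw [this]
      exact Nat.le_add_left _ _
    · have h5 : IsUpRightStep y (n, m) := h1.2.2 y (by simp) _ (by simp)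
      have h6 := ih y.1 y.2 ⟨h1.1, by simpa using h2, by simp⟩
      have h7 := latticeTime_add_le_of_step w h5
      rw [List.map_append, List.sum_append]
      simp only [List.map_cons, List.map_nil, List.sum_singleton]
      exact (Nat.add_le_add_right h6 _).trans h7

theorem exists_path_sum_eq_latticeTime (w : ℕ+ × ℕ+ → ℕ) (a b : ℕ) :
    ∃ p, IsUpRightPath a.succPNat b.succPNat p ∧
      (p.map w).sum = latticeTime w (a + 1) (b + 1) := by
  have right : ∀ a b, (∃ p, IsUpRightPath a.succPNat b.succPNat p ∧
      (p.map w).sum = latticeTime w (a + 1) (b + 1)) →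
      latticeTime w (a + 2) b ≤ latticeTime w (a + 1) (b + 1) →
      ∃ p, IsUpRightPath (a + 1).succPNat b.succPNat p ∧
      (p.map w).sum = latticeTime w (a + 2) (b + 1) := by
    rintro a b ⟨p, hp, hs⟩ hle
    refine ⟨_, hp.concat (Or.inl rfl), ?_⟩
    rw [List.map_append, List.sum_append, hs, latticeTime_succ_succ w (a + 1) b,
      max_eq_left hle]
    simp
  have up : ∀ a b, (∃ p, IsUpRightPath a.succPNat b.succPNat p ∧
      (p.map w).sum = latticeTime w (a + 1) (b + 1)) →
      latticeTime w a (b + 2) ≤ latticeTime w (a + 1) (b + 1) →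
      ∃ p, IsUpRightPath a.succPNat (b + 1).succPNat p ∧
      (p.map w).sum = latticeTime w (a + 1) (b + 2) := by
    rintro a b ⟨p, hp, hs⟩ hle
    refine ⟨_, hp.concat (Or.inr rfl), ?_⟩
    rw [List.map_append, List.sum_append, hs, latticeTime_succ_succ w a (b + 1),
      max_eq_right hle]
    simp
  induction a generalizing b with
  | zero =>
    induction b with
    | zero => exact ⟨[(1, 1)], ⟨List.isChain_singleton _, rfl, rfl⟩, by simp [latticeTime]; rfl⟩
    | succ b ih => exact up 0 b ih (by simp [latticeTime])
  | succ a iha =>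
    induction b with
    | zero => exact right a 0 (iha 0) (by simp [latticeTime])
    | succ b ihb =>
      rcases le_total (latticeTime w (a + 2) (b + 1)) (latticeTime w (a + 1) (b + 2)) with h | h
      · exact right a (b + 1) (iha (b + 1)) h
      · exact up (a + 1) b ihb h

theorem lastPassageTime_eq_latticeTime (w : ℕ+ × ℕ+ → ℕ) (n m : ℕ+) :
    lastPassageTime w n m = latticeTime w n m := by
  refine (isGreatest_lastPassageTime w n m).unique ⟨?_, ?_⟩
  · obtain ⟨p, hp, hs⟩ := exists_path_sum_eq_latticeTime w n.natPred m.natPred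
    rw [PNat.succPNat_natPred, PNat.succPNat_natPred] at hp
    rw [PNat.natPred_add_one, PNat.natPred_add_one] at hs
    exact ⟨p, hp, hs.symm⟩
  · rintro s ⟨p, hp, rfl⟩
    exact sum_le_latticeTime w p n m hp

end Recursion

/-! ### The Markov chain of last passage times -/

section Chain

open MeasureTheory ProbabilityTheory
open scoped ENNReal

/-- The `k`-th site, when the sites of a strip of height `M + 1` are listed column by column. -/
def stripSite (M k : ℕ) : ℕ+ × ℕ+ := ((k / (M + 1)).succPNat, (k % (M + 1)).succPNat)

theorem stripSite_injective (M : ℕ) : Function.Injective (stripSite M) := by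
  intro k k' h
  have h1 := Nat.succPNat_injective (congrArg Prod.fst h)
  have h2 := Nat.succPNat_injective (congrArg Prod.snd h)
  rw [← Nat.div_add_mod k (M + 1), ← Nat.div_add_mod k' (M + 1), h1, h2]

/-- The coordinate which is updated at the `k`-th site. -/
def stripRow (M k : ℕ) : Fin (M + 1) := ⟨k % (M + 1), Nat.mod_lt _ M.succ_pos⟩

/-- The state of the strip after the first `k` sites, with the weights `v`, have been visited:
the last passage times to the row ends of the visited region, made monotone by the pushing. -/
def stripState (M : ℕ) (v : ℕ → ℕ) : ℕ → Fin (M + 1) → ℕ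
  | 0 => 0
  | k + 1 => pushJump (stripRow M k) (stripState M v k) (v k)

theorem stripState_monotone (M : ℕ) (v : ℕ → ℕ) (k : ℕ) : Monotone (stripState M v k) := by
  induction k with
  | zero => exact monotone_const
  | succ k ih => exact pushJump_monotone ih _

theorem stripState_congr (M : ℕ) {v v' : ℕ → ℕ} (k : ℕ) (h : ∀ j < k, v j = v' j) :
    stripState M v k = stripState M v' k := by
  induction k with
  | zero => rfl
  | succ k ih =>
    rw [stripState, stripState, ih fun j hj => h j (hj.trans k.lt_succ_self), h k k.lt_succ_self]

theorem stripState_step (M : ℕ) (w : ℕ+ × ℕ+ → ℕ) (a i : ℕ) (hi : i + 1 ≤ M + 1)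
    (b : Fin (M + 1))
    (ih : ∀ b : Fin (M + 1), stripState M (fun k => w (stripSite M k)) (a * (M + 1) + i) b =
      if (b : ℕ) < i then latticeTime w (a + 1) (b + 1)
      else max (latticeTime w a (b + 1)) (latticeTime w (a + 1) i)) :
    stripState M (fun k => w (stripSite M k)) (a * (M + 1) + (i + 1)) b =
      if (b : ℕ) < i + 1 then latticeTime w (a + 1) (b + 1)
      else max (latticeTime w a (b + 1)) (latticeTime w (a + 1) (i + 1)) := by
  have hmod : (a * (M + 1) + i) % (M + 1) = i := by
    rw [add_comm, Nat.add_mul_mod_self_right, Nat.mod_eq_of_lt (by omega)]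
  have hdiv : (a * (M + 1) + i) / (M + 1) = a := by
    rw [add_comm, Nat.add_mul_div_right _ _ M.succ_pos, Nat.div_eq_of_lt (by omega), zero_add]
  rw [← add_assoc, stripState, pushJump]
  have hval : (stripRow M (a * (M + 1) + i) : ℕ) = i := hmod
  have hlt : b < stripRow M (a * (M + 1) + i) ↔ (b : ℕ) < i := by
    rw [Fin.lt_def, hval]
  have hrow : stripState M (fun k => w (stripSite M k)) (a * (M + 1) + i)
      (stripRow M (a * (M + 1) + i)) + w (stripSite M (a * (M + 1) + i)) =
      latticeTime w (a + 1) (i + 1) := by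
    rw [ih, hval, stripSite, hmod, hdiv, latticeTime_succ_succ, if_neg (lt_irrefl i)]
  simp only [hlt, hrow, ih b]
  have := latticeTime_le_succ_right w a i
  rcases lt_trichotomy (b : ℕ) i with h | h | h
  · rw [if_pos h, if_pos h, if_pos (by omega)]
  · have := latticeTime_succ_succ w a i
    rw [if_neg (by omega), if_neg (by omega), if_pos (by omega), h]
    omega
  · rw [if_neg (by omega), if_neg (by omega), if_neg (by omega)]
    omega

/-- During column `a + 1`, the state consists of the new last passage times in the rows already
visited, and of the old ones, pushed by the newest one, in the other rows. -/
theorem stripState_eq (M : ℕ) (w : ℕ+ × ℕ+ → ℕ) (a i : ℕ) (hi : i ≤ M + 1) (b : Fin (M + 1)) :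
    stripState M (fun k => w (stripSite M k)) (a * (M + 1) + i) b =
      if (b : ℕ) < i then latticeTime w (a + 1) (b + 1)
      else max (latticeTime w a (b + 1)) (latticeTime w (a + 1) i) := by
  induction a generalizing i b with
  | zero =>
    induction i generalizing b with
    | zero => simp [stripState, latticeTime]
    | succ i ih => exact stripState_step M w 0 i hi b (fun b => ih (by omega) b)
  | succ a iha =>
    induction i generalizing b with
    | zero =>
      have := iha (M + 1) le_rfl b
      rw [if_pos b.2] at this
      rw [add_zero, Nat.succ_mul, this, if_neg (Nat.not_lt_zero _), latticeTime_zero_right,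
        Nat.max_zero]
    | succ i ih => exact stripState_step M w (a + 1) i hi b (fun b => ih (by omega) b)

/-- How often the coordinate `b` is still to be updated, after the first `k` of the sites of `n`
columns. -/
def jumpsLeft (M n k : ℕ) (b : Fin (M + 1)) : ℕ :=
  n - k / (M + 1) - if (b : ℕ) < k % (M + 1) then 1 else 0

theorem jumpsLeft_zero (M n : ℕ) : jumpsLeft M n 0 = fun _ => n := by
  ext b
  simp [jumpsLeft]

theorem jumpsLeft_end (M n : ℕ) : jumpsLeft M n (n * (M + 1)) = 0 := by
  ext b
  simp [jumpsLeft]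

theorem jumpsLeft_of_le {M n k : ℕ} {b : Fin (M + 1)} (hb : stripRow M k ≤ b) :
    jumpsLeft M n k b = n - k / (M + 1) := by
  have : k % (M + 1) ≤ b := hb
  rw [jumpsLeft, if_neg (by omega), Nat.sub_zero]

theorem jumpsLeft_succ (M n k : ℕ) : jumpsLeft M n (k + 1) =
    Function.update (jumpsLeft M n k) (stripRow M k) (n - k / (M + 1) - 1) := by
  have hlt : k % (M + 1) < M + 1 := Nat.mod_lt _ M.succ_pos
  ext b
  have hb := b.2
  have hrow : (b = stripRow M k) ↔ (b : ℕ) = k % (M + 1) := Fin.ext_iff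
  rw [Function.update_apply]
  simp only [hrow, jumpsLeft]
  have hk := Nat.mod_add_div k (M + 1)
  generalize k % (M + 1) = i at *
  generalize k / (M + 1) = q at *
  subst hk
  rcases Nat.lt_succ_iff_lt_or_eq.1 hlt with h | rfl
  · obtain ⟨h1, h2⟩ := (Nat.div_mod_unique (a := i + (M + 1) * q + 1) (c := i + 1) (d := q)
      M.succ_pos).2 ⟨by rw [Nat.succ_eq_add_one]; ring, by omega⟩
    rw [h1, h2]
    split_ifs <;> omega
  · obtain ⟨h1, h2⟩ := (Nat.div_mod_unique (a := i + (i + 1) * q + 1) (c := 0) (d := q + 1)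
      i.succ_pos).2 ⟨by rw [Nat.succ_eq_add_one]; ring, by omega⟩
    rw [h1, h2]
    split_ifs <;> omega

theorem backwardDet_eq_sum {M l : ℕ} {t : ℝ} {r x : Fin (M + 1) → ℕ} {i : Fin (M + 1)} {s : ℕ}
    (hx : Monotone x) (hs : r i = s + 1) (hr : ∀ b, i ≤ b → r b = r i) (N : ℕ) :
    backwardDet M l t r x =
      ∑ k ∈ Finset.range N, (1 - t) * t ^ k *
        backwardDet M l t (Function.update r i s) (pushJump i x k) +
      t ^ N * backwardDet M l t r (pushJump i x N) := by
  induction N with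
  | zero => simp [pushJump_zero hx]
  | succ N ih =>
    rw [ih, Finset.sum_range_succ,
      backwardDet_recursion (pushJump_monotone hx N) hs hr, pushJump_pushJump]
    ring

theorem backwardDet_eq_sum_of_large {M l : ℕ} {t : ℝ} {r x : Fin (M + 1) → ℕ} {i : Fin (M + 1)}
    {s : ℕ} (hx : Monotone x) (hs : r i = s + 1) (hr : ∀ b, i ≤ b → r b = r i) :
    backwardDet M l t r x =
      ∑ k ∈ Finset.range (l + M + 1), (1 - t) * t ^ k *
        backwardDet M l t (Function.update r i s) (pushJump i x k) := by
  rw [backwardDet_eq_sum hx hs hr (l + M + 1), backwardDet_of_lt (i := i), mul_zero, add_zero]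
  simp only [pushJump, lt_irrefl, if_false]
  omega

theorem backwardDet_jumpsLeft_nonneg {M l n : ℕ} {t : ℝ} (h0 : 0 ≤ t) (h1 : t ≤ 1) {k : ℕ}
    (hk : k ≤ n * (M + 1)) {x : Fin (M + 1) → ℕ} (hx : Monotone x) :
    0 ≤ backwardDet M l t (jumpsLeft M n k) x := by
  induction hk using Nat.decreasingInduction generalizing x with
  | self =>
    rw [jumpsLeft_end, backwardDet_terminal M l t hx]
    positivity
  | of_succ k hk ih =>
    have hkn : k / (M + 1) < n := (Nat.div_lt_iff_lt_mul M.succ_pos).2 hk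
    rw [backwardDet_eq_sum_of_large (i := stripRow M k) (s := n - k / (M + 1) - 1) hx
      (by rw [jumpsLeft_of_le le_rfl]; omega)
      (fun b hb => by rw [jumpsLeft_of_le hb, jumpsLeft_of_le le_rfl]), ← jumpsLeft_succ]
    exact Finset.sum_nonneg fun j _ => mul_nonneg
      (mul_nonneg (sub_nonneg.2 h1) (pow_nonneg h0 j)) (ih (pushJump_monotone hx j))

/-- The backward equation, in the form of an expectation over the next weight. -/
theorem ofReal_backwardDet_eq_tsum {M l n : ℕ} {t : ℝ} (h0 : 0 ≤ t) (h1 : t ≤ 1) {k : ℕ}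
    (hk : k < n * (M + 1)) {x : Fin (M + 1) → ℕ} (hx : Monotone x) :
    ENNReal.ofReal (backwardDet M l t (jumpsLeft M n k) x) =
      ∑' j, ENNReal.ofReal ((1 - t) * t ^ j) * ENNReal.ofReal
        (backwardDet M l t (jumpsLeft M n (k + 1)) (pushJump (stripRow M k) x j)) := by
  have hkn : k / (M + 1) < n := (Nat.div_lt_iff_lt_mul M.succ_pos).2 hk
  have hp : ∀ j, 0 ≤ (1 - t) * t ^ j := fun j => mul_nonneg (sub_nonneg.2 h1) (pow_nonneg h0 j)
  rw [backwardDet_eq_sum_of_large (i := stripRow M k) (s := n - k / (M + 1) - 1) hx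
      (by rw [jumpsLeft_of_le le_rfl]; omega)
      (fun b hb => by rw [jumpsLeft_of_le hb, jumpsLeft_of_le le_rfl]), ← jumpsLeft_succ,
    ENNReal.ofReal_sum_of_nonneg fun j _ => mul_nonneg (hp j)
      (backwardDet_jumpsLeft_nonneg h0 h1 hk (pushJump_monotone hx j)),
    tsum_eq_sum (s := Finset.range (l + M + 1))]
  · exact Finset.sum_congr rfl fun j _ => ENNReal.ofReal_mul (hp j)
  · intro j hj
    rw [backwardDet_of_lt (i := stripRow M k), ENNReal.ofReal_zero, mul_zero]
    simp only [pushJump, lt_irrefl, if_false]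
    have := Finset.mem_range.not.1 hj
    omega

variable {Ω : Type*} [MeasurableSpace Ω] {P : Measure Ω}

theorem lintegral_comp_of_indepFun {S : Type*} [MeasurableSpace S] [DiscreteMeasurableSpace S]
    {X : Ω → S} {W : Ω → ℕ} (hX : Measurable X) (hW : Measurable W) (h : IndepFun X W P)
    (f : S → ℕ → ℝ≥0∞) :
    ∫⁻ ω, f (X ω) (W ω) ∂P = ∫⁻ ω, ∑' k, P {ω' | W ω' = k} * f (X ω) k ∂P := by
  have hm : ∀ k, Measurable fun ω => f (X ω) k := fun k =>
    (Measurable.of_discrete (f := fun x => f x k)).comp hX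
  have hi : ∀ k, Measurable fun n : ℕ => if n = k then (1 : ℝ≥0∞) else 0 := fun _ =>
    Measurable.of_discrete
  have h1 : ∀ ω, f (X ω) (W ω) = ∑' k, f (X ω) k * if W ω = k then 1 else 0 := by
    intro ω
    rw [tsum_eq_single (W ω) fun k hk => by rw [if_neg hk.symm, mul_zero], if_pos rfl, mul_one]
  simp_rw [h1]
  have hmi : ∀ k, Measurable fun ω => f (X ω) k * if W ω = k then 1 else 0 := fun k =>
    (hm k).mul ((hi k).comp hW)
  rw [lintegral_tsum fun k => (hmi k).aemeasurable, lintegral_tsum fun k => ((hm k).const_mul _).aemeasurable]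
  refine tsum_congr fun k => ?_
  have h2 := lintegral_mul_eq_lintegral_mul_lintegral_of_indepFun (hm k) ((hi k).comp hW)
    (h.comp (φ := fun x => f x k) Measurable.of_discrete (hi k))
  simp only [Pi.mul_apply, Function.comp_apply] at h2
  rw [h2, lintegral_const_mul _ (hm k), mul_comm]
  congr 1
  have h3 : {ω' | W ω' = k} = W ⁻¹' {k} := rfl
  rw [h3, ← lintegral_indicator_one (hW (measurableSet_singleton k))]
  refine lintegral_congr fun ω => ?_
  by_cases hk : W ω = k
  · rw [if_pos hk, Set.indicator_of_mem (by exact hk), Pi.one_apply]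
  · rw [if_neg hk, Set.indicator_of_notMem (by exact hk)]

theorem indepFun_stripState {M : ℕ} {v : ℕ → Ω → ℕ} (hv : ∀ k, Measurable (v k))
    (h : iIndepFun v P) (k : ℕ) :
    Measurable (fun ω => stripState M (fun j => v j ω) k) ∧
      IndepFun (fun ω => stripState M (fun j => v j ω) k) (v k) P := by
  let F : (Finset.range k → ℕ) → Fin (M + 1) → ℕ := fun u =>
    stripState M (fun j => if hj : j ∈ Finset.range k then u ⟨j, hj⟩ else 0) k
  have hF : (fun ω => stripState M (fun j => v j ω) k) =
      F ∘ fun ω (j : Finset.range k) => v j ω := by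
    ext1 ω
    refine stripState_congr M k fun j hj => ?_
    simp [hj]
  have h1 := h.indepFun_finset (Finset.range k) {k} (by simp) hv
  rw [hF]
  refine ⟨(Measurable.of_discrete (f := F)).comp (measurable_pi_lambda _ fun j => hv j), ?_⟩
  exact h1.comp (φ := F) (ψ := fun u : ({k} : Finset ℕ) → ℕ => u ⟨k, Finset.mem_singleton_self k⟩)
    Measurable.of_discrete Measurable.of_discrete

/-- The law of the last passage time is a determinant: the determinants along the chain form a
martingale. -/
theorem measure_lastPassageTime_le [IsProbabilityMeasure P] {t : ℝ} (h0 : 0 ≤ t) (h1 : t ≤ 1)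
    {w : ℕ+ × ℕ+ → Ω → ℕ} (hmeas : ∀ s, Measurable (w s)) (hindep : iIndepFun w P)
    (hgeom : ∀ s k, P {ω | w s ω = k} = ENNReal.ofReal ((1 - t) * t ^ k)) (n m : ℕ+)
    {M : ℕ} (hM : (m : ℕ) = M + 1) (l : ℕ) :
    P {ω | lastPassageTime (fun s => w s ω) n m ≤ l} =
      ENNReal.ofReal (backwardDet M l t (fun _ => n) 0) := by
  set v : ℕ → Ω → ℕ := fun k => w (stripSite M k) with hv
  have hvm : ∀ k, Measurable (v k) := fun k => hmeas _
  have hvi : iIndepFun v P := hindep.precomp (stripSite_injective M)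
  have key : ∀ k ≤ n * (M + 1), ∫⁻ ω, ENNReal.ofReal
      (backwardDet M l t (jumpsLeft M n k) (stripState M (fun j => v j ω) k)) ∂P =
      ENNReal.ofReal (backwardDet M l t (fun _ => n) 0) := by
    intro k
    induction k with
    | zero => intro _; simp [stripState, jumpsLeft_zero]
    | succ k ih =>
      intro hk
      rw [← ih (by omega)]
      obtain ⟨hX, hXv⟩ := indepFun_stripState (M := M) hvm hvi k
      refine (lintegral_comp_of_indepFun hX (hvm k) hXv fun x j => ENNReal.ofReal
        (backwardDet M l t (jumpsLeft M n (k + 1)) (pushJump (stripRow M k) x j))).trans ?_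
      refine lintegral_congr fun ω => ?_
      rw [ofReal_backwardDet_eq_tsum h0 h1 hk (stripState_monotone M _ k)]
      simp only [hv, hgeom]
  rw [← key _ le_rfl, jumpsLeft_end]
  have hlast : ∀ ω, stripState M (fun j => v j ω) (n * (M + 1)) (Fin.last M) =
      lastPassageTime (fun s => w s ω) n m := by
    intro ω
    have := stripState_eq M (fun s => w s ω) n 0 (Nat.zero_le _) (Fin.last M)
    rw [if_neg (Nat.not_lt_zero _), add_zero, latticeTime_zero_right, Nat.max_zero,
      Fin.val_last, ← hM] at this
    rw [lastPassageTime_eq_latticeTime, ← this, hM]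
  have hms : MeasurableSet {ω | lastPassageTime (fun s => w s ω) n m ≤ l} := by
    simp_rw [← hlast]
    exact ((measurable_pi_apply (Fin.last M)).comp (indepFun_stripState hvm hvi _).1)
      (measurableSet_Iic (a := l))
  rw [← lintegral_indicator_one hms]
  refine lintegral_congr fun ω => ?_
  rw [backwardDet_terminal M l t (stripState_monotone M _ _), hlast, Set.indicator_apply]
  simp only [Set.mem_ofPred_eq, Pi.one_apply]
  split_ifs <;> simp

end Chain

/-! ### Determinants of bilinear forms in different bases -/

section Basis

open Polynomial

variable {S : Type*} [CommRing S] [Algebra ℝ S]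

/-- Changing the polynomials of `y` in the rows multiplies the determinant by the determinant of
their coefficients. -/
theorem det_linearMap_aeval_mul (Λ : S →ₗ[ℝ] ℝ) (y : S) {N : ℕ} (p : Fin N → ℝ[X])
    (hp : ∀ i, (p i).natDegree < N) (q : Fin N → S) :
    (Matrix.of fun i j => Λ (aeval y (p i) * q j)).det =
      (Matrix.of fun i k : Fin N => (p i).coeff k).det *
        (Matrix.of fun i j : Fin N => Λ (y ^ (i : ℕ) * q j)).det := by
  rw [← Matrix.det_mul]
  congr 1
  ext i j
  rw [Matrix.mul_apply]
  simp only [Matrix.of_apply]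
  rw [aeval_eq_sum_range' (hp i), Finset.sum_mul, map_sum,
    ← Fin.sum_univ_eq_sum_range (fun k => Λ ((p i).coeff k • y ^ k * q j))]
  simp

theorem det_linearMap_pow_mul_aeval_mul (Λ : S →ₗ[ℝ] ℝ) (y : S) {N : ℕ} (r : Fin N → ℝ[X])
    (h0 : ∀ i, (r i).coeff 0 = 1) (hr : ∀ i, (r i).natDegree < N - i) (q : Fin N → S) :
    (Matrix.of fun i j : Fin N => Λ (y ^ (i : ℕ) * aeval y (r i) * q j)).det =
      (Matrix.of fun i j : Fin N => Λ (y ^ (i : ℕ) * q j)).det := by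
  have h1 := det_linearMap_aeval_mul Λ y (fun i : Fin N => X ^ (i : ℕ) * r i) (fun i => by
    have := hr i
    refine natDegree_mul_le.trans_lt ?_
    rw [natDegree_X_pow]
    omega) q
  simp only [map_mul, map_pow, aeval_X] at h1
  rw [h1, Matrix.det_of_isUpperTriangular, Finset.prod_eq_one, one_mul]
  · intro i _
    rw [Matrix.of_apply, coeff_X_pow_mul', if_pos le_rfl, Nat.sub_self, h0]
  · intro i k hik
    have hik : (k : ℕ) < i := hik
    rw [Matrix.of_apply, coeff_X_pow_mul', if_neg (not_le.2 hik)]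

/-- The change of basis from `X ^ i * (1 - s X) ^ (M - i)` to `X ^ i` is unitriangular. -/
theorem det_linearMap_pow_mul_one_sub_pow (Λ : S →ₗ[ℝ] ℝ) (y : S) (s : ℝ) {M : ℕ}
    (q : Fin (M + 1) → S) :
    (Matrix.of fun i j : Fin (M + 1) =>
      Λ (y ^ (i : ℕ) * (1 - algebraMap ℝ S s * y) ^ (M - i) * q j)).det =
      (Matrix.of fun i j : Fin (M + 1) => Λ (y ^ (i : ℕ) * q j)).det := by
  have h := det_linearMap_pow_mul_aeval_mul Λ y
    (fun i : Fin (M + 1) => (1 - C s * X) ^ (M - i)) (fun i => ?_) (fun i => ?_) q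
  · simpa using h
  · simp [coeff_zero_eq_eval_zero]
  · have h1 : (1 - C s * X).natDegree ≤ 1 := by compute_degree
    have h2 := natDegree_pow_le_of_le (M - i) h1
    have := i.2
    omega

theorem det_of_mul_mul {N : ℕ} (u v : Fin N → ℝ) (f : Fin N → Fin N → ℝ) :
    (Matrix.of fun i j => u i * v j * f i j).det =
      (∏ i, u i) * (∏ j, v j) * (Matrix.of f).det := by
  have h1 := Matrix.det_mul_column u (Matrix.of fun i j => v j * f i j)
  have h2 := Matrix.det_mul_row v (Matrix.of f)
  simp only [Matrix.of_apply] at h1 h2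
  rw [mul_assoc, ← h2, ← h1]
  simp only [mul_assoc]

end Basis

/-! ### The determinant of the last passage time as a determinant of integrals -/

section Hankel

open PowerSeries

theorem coeff_geomSeries_pow (t : ℝ) (d k : ℕ) :
    coeff k (geomSeries t ^ (d + 1)) = t ^ k * ((d + k).choose d : ℝ) := by
  have h : geomSeries t = rescale t (PowerSeries.mk 1) := by
    ext k
    simp [geomSeries]
  rw [h, ← map_pow, mk_one_pow_eq_mk_choose_add, coeff_rescale, coeff_mk]

theorem backwardDet_const_zero (M l : ℕ) (t : ℝ) (n : ℕ) :
    backwardDet M l t (fun _ => n) 0 = ((1 - t) ^ n) ^ (M + 1) *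
      (Matrix.of fun i j : Fin (M + 1) => coeff (l + M) (X ^ (i : ℕ) *
        (1 - C t * X) ^ (M - i) * (1 - X) ^ (j : ℕ) *
          (geomSeries 1 ^ (M + 1) * geomSeries t ^ n))).det := by
  set Λ : ℝ⟦X⟧ →ₗ[ℝ] ℝ := (PowerSeries.coeff (R := ℝ) (l + M)) ∘ₗ
    LinearMap.mulRight ℝ (geomSeries 1 ^ (M + 1) * geomSeries t ^ n) with hΛ
  have e1 : backwardDet M l t (fun _ => n) 0 = (Matrix.of fun i j : Fin (M + 1) =>
      (1 - t) ^ n * 1 * Λ (X ^ (i : ℕ) * (1 - algebraMap ℝ ℝ⟦X⟧ 1 * X) ^ (M - i) *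
        (X ^ (M - j) * (1 - X) ^ (j : ℕ)))).det := by
    unfold backwardDet
    congr 1
    ext i j
    simp only [Matrix.of_apply, hΛ, LinearMap.comp_apply, LinearMap.mulRight_apply, kernelEntry,
      Pi.zero_apply, pow_zero, one_mul, mul_one, map_one]
    rw [← coeff_C_mul, kernelSeries, geomGF, mul_pow, ← map_pow]
    congr 1
    ring
  have e2 : (Matrix.of fun i j : Fin (M + 1) => coeff (l + M) (X ^ (i : ℕ) *
        (1 - C t * X) ^ (M - i) * (1 - X) ^ (j : ℕ) *
          (geomSeries 1 ^ (M + 1) * geomSeries t ^ n))).det =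
      (Matrix.of fun i j : Fin (M + 1) => Λ (X ^ (i : ℕ) *
        (1 - algebraMap ℝ ℝ⟦X⟧ t * X) ^ (M - i) * (1 - X) ^ (j : ℕ))).det := rfl
  have e3 := det_linearMap_pow_mul_one_sub_pow Λ (1 - X) 1
    (fun i : Fin (M + 1) => (X : ℝ⟦X⟧) ^ (i : ℕ))
  rw [← Matrix.det_transpose, ← Matrix.det_transpose (Matrix.of _)] at e3
  rw [e1, e2]
  refine (det_of_mul_mul (fun _ => (1 - t) ^ n) (fun _ => 1) _).trans ?_
  rw [det_linearMap_pow_mul_one_sub_pow, det_linearMap_pow_mul_one_sub_pow, Finset.prod_const,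
    Finset.card_univ, Fintype.card_fin, Finset.prod_const_one, mul_one]
  congr 1
  convert e3 using 2
  · ext i j
    simp only [Matrix.of_apply, Matrix.transpose_apply, map_one, one_mul, sub_sub_cancel]
    congr 1
    ring
  · ext i j
    simp only [Matrix.of_apply, Matrix.transpose_apply]
    congr 1
    ring

theorem backwardDet_zero_parameter (M l n : ℕ) : backwardDet M l 0 (fun _ => n) 0 = 1 := by
  have h : geomGF 0 = 1 := by
    have := geomGF_eq 0
    simpa using this
  have h2 := backwardDet_terminal M l 0 (x := 0) monotone_const
  rw [Pi.zero_apply, if_pos (Nat.zero_le l)] at h2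
  rw [← h2]
  unfold backwardDet kernelEntry kernelSeries
  simp [h]

theorem integral_pow_mul_one_sub_pow (p q : ℕ) :
    ∫ x in (0 : ℝ)..1, x ^ p * (1 - x) ^ q = p.factorial * q.factorial / (p + q + 1).factorial := by
  induction q generalizing p with
  | zero =>
    have : (p.factorial : ℝ) ≠ 0 := by positivity
    simp [Nat.factorial_succ]
    field_simp
  | succ q ih =>
    have hd : ∀ x ∈ Set.uIcc (0 : ℝ) 1, HasDerivAt (fun x : ℝ => x ^ (p + 1) * (1 - x) ^ (q + 1))
        ((p + 1) * (x ^ p * (1 - x) ^ (q + 1)) - (q + 1) * (x ^ (p + 1) * (1 - x) ^ q)) x := by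
      intro x _
      have h1 := hasDerivAt_pow (p + 1) x
      have h2 := ((hasDerivAt_id x).const_sub 1).pow (q + 1)
      refine (h1.mul h2).congr_deriv ?_
      simp
      ring
    have h := intervalIntegral.integral_eq_sub_of_hasDerivAt hd
      (Continuous.intervalIntegrable (by fun_prop) _ _)
    rw [intervalIntegral.integral_sub (Continuous.intervalIntegrable (by fun_prop) _ _)
      (Continuous.intervalIntegrable (by fun_prop) _ _), intervalIntegral.integral_const_mul,
      intervalIntegral.integral_const_mul, ih] at h
    have e : p + 1 + q + 1 = p + (q + 1) + 1 := by ring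
    rw [e, Nat.factorial_succ p] at h
    have hp : ((p : ℝ) + 1) ≠ 0 := by positivity
    rw [← mul_right_inj' hp, Nat.factorial_succ q]
    simp at h
    push_cast
    rw [sub_eq_zero] at h
    rw [h]
    ring

/-- The scaled beta integral with an extra factor `(1 - x) ^ u`, expanded in powers of `t`. -/
theorem integral_pow_mul_one_sub_pow_mul_sub_pow (t : ℝ) (p u v : ℕ) :
    ∫ x in (0 : ℝ)..(1 - t), x ^ p * (1 - x) ^ u * (1 - t - x) ^ v =
      (1 - t) ^ (p + v + 1) * (p.factorial * u.factorial * v.factorial / (p + u + v + 1).factorial) *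
        coeff u (geomSeries t ^ (p + 1) * geomSeries 1 ^ (v + 1)) := by
  have h1 := intervalIntegral.mul_integral_comp_mul_left (a := 0) (b := 1)
    (f := fun x : ℝ => x ^ p * (1 - x) ^ u * (1 - t - x) ^ v) (c := 1 - t)
  rw [mul_zero, mul_one] at h1
  have h2 : ∀ y : ℝ, ((1 - t) * y) ^ p * (1 - (1 - t) * y) ^ u * (1 - t - (1 - t) * y) ^ v =
      ∑ g ∈ Finset.HasAntidiagonal.antidiagonal u, (1 - t) ^ (p + v) * (u.choose g.1 * t ^ g.1) *
        (y ^ (p + g.1) * (1 - y) ^ (v + g.2)) := by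
    intro y
    rw [show 1 - (1 - t) * y = t * y + (1 - y) by ring,
      show 1 - t - (1 - t) * y = (1 - t) * (1 - y) by ring, (Commute.all _ _).add_pow',
      Finset.mul_sum, Finset.sum_mul]
    refine Finset.sum_congr rfl fun g _ => ?_
    rw [nsmul_eq_mul, mul_pow _ y p, mul_pow _ (1 - y) v]
    ring
  rw [← h1]
  simp_rw [h2]
  rw [intervalIntegral.integral_finsetSum fun g _ =>
      Continuous.intervalIntegrable (by fun_prop) _ _, coeff_mul, Finset.mul_sum, Finset.mul_sum]
  refine Finset.sum_congr rfl fun g hg => ?_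
  rw [Finset.HasAntidiagonal.mem_antidiagonal] at hg
  rw [intervalIntegral.integral_const_mul, integral_pow_mul_one_sub_pow, coeff_geomSeries_pow,
    coeff_geomSeries_pow, one_pow, one_mul, ← hg, Nat.cast_add_choose,
    Nat.cast_add_choose, Nat.cast_add_choose,
    show p + g.1 + (v + g.2) + 1 = p + (g.1 + g.2) + v + 1 by ring]
  have h3 : ∀ k : ℕ, (k.factorial : ℝ) ≠ 0 := fun k => by positivity
  field_simp [h3]
  ring

/-- The linear functional `f ↦ ∫₀^ε f(x) x ^ a (1 - x) ^ l dx` on polynomials. -/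
noncomputable def jacobiFunctional (a l : ℕ) (ε : ℝ) : Polynomial ℝ →ₗ[ℝ] ℝ where
  toFun f := ∫ x in (0 : ℝ)..ε, f.eval x * (x ^ a * (1 - x) ^ l)
  map_add' f g := by
    simp only [Polynomial.eval_add, add_mul]
    exact intervalIntegral.integral_add (Continuous.intervalIntegrable (by fun_prop) _ _)
      (Continuous.intervalIntegrable (by fun_prop) _ _)
  map_smul' c f := by
    simp only [Polynomial.eval_smul, smul_eq_mul, mul_assoc, RingHom.id_apply]
    exact intervalIntegral.integral_const_mul _ _

/-- The Hankel determinant of the Jacobi weight on the truncated interval `[0, ε]`. -/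
noncomputable def jacobiHankel (N a l : ℕ) (ε : ℝ) : ℝ :=
  (Matrix.of fun i j : Fin N =>
    ∫ x in (0 : ℝ)..ε, x ^ (i : ℕ) * x ^ (j : ℕ) * (x ^ a * (1 - x) ^ l)).det

/-- Up to a sign, the reversed powers of `ε - X` are a unitriangular basis. -/
theorem det_coeff_C_sub_X_pow (M : ℕ) (ε : ℝ) :
    (Matrix.of fun j k : Fin (M + 1) =>
      ((Polynomial.C ε - Polynomial.X) ^ (M - j) : Polynomial ℝ).coeff k).det =
      (Equiv.Perm.sign (Fin.revPerm (n := M + 1)) : ℝ) *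
        ∏ j : Fin (M + 1), (-1) ^ (j : ℕ) := by
  have h1 : (Matrix.of fun k j : Fin (M + 1) =>
      ((Polynomial.X - Polynomial.C ε) ^ (j : ℕ) : Polynomial ℝ).coeff k).det = 1 :=
    Matrix.det_matrixOfPolynomials (fun j => (Polynomial.X - Polynomial.C ε) ^ (j : ℕ))
      (fun j => by simp) (fun j => (Polynomial.monic_X_sub_C ε).pow _)
  rw [← Matrix.det_transpose] at h1
  have h2 := Matrix.det_mul_column (fun j : Fin (M + 1) => (-1 : ℝ) ^ (j : ℕ))
    (Matrix.of fun k j : Fin (M + 1) =>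
      ((Polynomial.X - Polynomial.C ε) ^ (j : ℕ) : Polynomial ℝ).coeff k).transpose
  rw [h1, mul_one] at h2
  rw [← h2, ← Matrix.det_permute]
  congr 1
  ext j k
  simp only [Matrix.of_apply, Matrix.submatrix_apply, Matrix.transpose_apply, id,
    Fin.revPerm_apply, Fin.val_rev, Nat.reduceSubDiff]
  rw [← neg_sub Polynomial.X, neg_pow, ← Polynomial.C_1, ← Polynomial.C_neg, ← Polynomial.C_pow,
    Polynomial.coeff_C_mul]

/-- The constants `c` and `K` depend on `M`, `a` and `l`, but not on `t`. -/
theorem exists_mul_jacobiHankel_eq (M a l : ℕ) : ∃ c K : ℝ, c ≠ 0 ∧ ∀ t : ℝ,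
    c * jacobiHankel (M + 1) a l (1 - t) =
      K * backwardDet M l t (fun _ => a + M + 1) 0 := by
  refine ⟨(Equiv.Perm.sign (Fin.revPerm (n := M + 1)) : ℝ) * ∏ j : Fin (M + 1), (-1) ^ (j : ℕ),
    (∏ i : Fin (M + 1), ((a + i).factorial * (l + M - i).factorial : ℝ)) *
      ∏ j : Fin (M + 1), ((M - j).factorial / (a + l + M + (M - j) + 1).factorial : ℝ), ?_,
    fun t => ?_⟩
  · refine mul_ne_zero ?_ (Finset.prod_ne_zero_iff.2 fun j _ => by simp)
    exact_mod_cast (Equiv.Perm.sign (Fin.revPerm (n := M + 1))).ne_zero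
  -- The Hankel determinant in bases whose entries match those of `backwardDet_const_zero`.
  have e1 : (Matrix.of fun i j : Fin (M + 1) => jacobiFunctional a l (1 - t)
      (Polynomial.X ^ (i : ℕ) * (1 - algebraMap ℝ (Polynomial ℝ) 1 * Polynomial.X) ^ (M - i) *
        (Polynomial.C (1 - t) - Polynomial.X) ^ (M - j))).det =
      (Equiv.Perm.sign (Fin.revPerm (n := M + 1)) : ℝ) * (∏ j : Fin (M + 1), (-1) ^ (j : ℕ)) *
        jacobiHankel (M + 1) a l (1 - t) := by
    have h := det_linearMap_aeval_mul (jacobiFunctional a l (1 - t)) Polynomial.X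
      (fun j : Fin (M + 1) => (Polynomial.C (1 - t) - Polynomial.X) ^ (M - j)) (fun j => by
        have h1 : (Polynomial.C (1 - t) - Polynomial.X).natDegree ≤ 1 := by compute_degree
        have h2 := Polynomial.natDegree_pow_le_of_le (M - j) h1
        omega) (fun i => Polynomial.X ^ (i : ℕ))
    rw [det_coeff_C_sub_X_pow] at h
    simp only [Polynomial.aeval_X_left_apply] at h
    rw [det_linearMap_pow_mul_one_sub_pow, ← Matrix.det_transpose]
    convert h using 2
    · ext i j
      simp only [Matrix.of_apply, Matrix.transpose_apply]
      congr 1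
      ring
    · unfold jacobiHankel jacobiFunctional
      simp
  rw [← e1, backwardDet_const_zero]
  have e2 : ∀ i j : Fin (M + 1), jacobiFunctional a l (1 - t)
      (Polynomial.X ^ (i : ℕ) * (1 - algebraMap ℝ (Polynomial ℝ) 1 * Polynomial.X) ^ (M - i) *
        (Polynomial.C (1 - t) - Polynomial.X) ^ (M - j)) =
      ((a + i).factorial * (l + M - i).factorial * (1 - t) ^ (a + 1 + i)) *
      ((M - j).factorial / (a + l + M + (M - j) + 1).factorial * (1 - t) ^ (M - j)) *
        coeff (l + M) (X ^ (i : ℕ) * (1 - C t * X) ^ (M - i) * (1 - X) ^ (j : ℕ) *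
          (geomSeries 1 ^ (M + 1) * geomSeries t ^ (a + M + 1))) := by
    intro i j
    obtain ⟨i', hi⟩ : ∃ i', M = i + i' := Nat.exists_eq_add_of_le (Nat.lt_succ_iff.1 i.2)
    obtain ⟨j', hj⟩ : ∃ j', M = j + j' := Nat.exists_eq_add_of_le (Nat.lt_succ_iff.1 j.2)
    have h1 : jacobiFunctional a l (1 - t) (Polynomial.X ^ (i : ℕ) *
        (1 - algebraMap ℝ (Polynomial ℝ) 1 * Polynomial.X) ^ (M - i) *
          (Polynomial.C (1 - t) - Polynomial.X) ^ (M - j)) =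
        ∫ x in (0 : ℝ)..(1 - t), x ^ (a + i) * (1 - x) ^ (l + i') * (1 - t - x) ^ j' := by
      unfold jacobiFunctional
      simp only [LinearMap.coe_mk, AddHom.coe_mk]
      congr 1
      ext x
      rw [show M - i = i' by omega, show M - j = j' by omega]
      simp
      ring
    have h2 : (X ^ (i : ℕ) * (1 - C t * X) ^ (M - i) * (1 - X) ^ (j : ℕ) *
        (geomSeries 1 ^ (M + 1) * geomSeries t ^ (a + M + 1)) : ℝ⟦X⟧) =
        X ^ (i : ℕ) * (geomSeries t ^ (a + i + 1) * geomSeries 1 ^ (j' + 1)) := by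
      have k1 : (1 - X : ℝ⟦X⟧) ^ (j : ℕ) * geomSeries 1 ^ (j : ℕ) = 1 := by
        rw [← mul_pow, one_sub_X_mul_geomSeries, one_pow]
      have k2 : (1 - C t * X : ℝ⟦X⟧) ^ i' * geomSeries t ^ i' = 1 := by
        rw [← mul_pow, one_sub_mul_geomSeries, one_pow]
      have k3 : geomSeries 1 ^ (M + 1) = geomSeries 1 ^ (j : ℕ) * geomSeries 1 ^ (j' + 1) := by
        rw [← pow_add]
        congr 1
        omega
      rw [k3, show M - i = i' by omega,
        show a + M + 1 = i' + (a + i + 1) by omega, pow_add (geomSeries t)]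
      linear_combination (X ^ (i : ℕ) * geomSeries t ^ (a + i + 1) * geomSeries 1 ^ (j' + 1)) *
        ((1 - C t * X : ℝ⟦X⟧) ^ i' * geomSeries t ^ i' * k1 + k2)
    rw [h1, h2, integral_pow_mul_one_sub_pow_mul_sub_pow, coeff_X_pow_mul', if_pos (by omega),
      show l + M - i = l + i' by omega, show M - j = j' by omega,
      show a + i + (l + i') + j' + 1 = a + l + M + j' + 1 by omega]
    ring
  simp_rw [e2]
  refine (det_of_mul_mul
    (fun i : Fin (M + 1) => ((a + i).factorial * (l + M - i).factorial *
      (1 - t) ^ (a + 1 + (i : ℕ)) : ℝ))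
    (fun j : Fin (M + 1) => ((M - j).factorial / (a + l + M + (M - j) + 1).factorial *
      (1 - t) ^ (M - (j : ℕ)) : ℝ)) _).trans ?_
  rw [Finset.prod_mul_distrib (g := fun i : Fin (M + 1) => (1 - t) ^ (a + 1 + (i : ℕ))),
    Finset.prod_mul_distrib (g := fun j : Fin (M + 1) => (1 - t) ^ (M - (j : ℕ)))]
  have e3 : (∏ j : Fin (M + 1), (1 - t) ^ (M - (j : ℕ))) *
      ∏ i : Fin (M + 1), (1 - t) ^ (a + 1 + (i : ℕ)) = ((1 - t) ^ (a + M + 1)) ^ (M + 1) := by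
    rw [← Finset.prod_mul_distrib]
    have : ∀ i : Fin (M + 1), (1 - t) ^ (M - (i : ℕ)) * (1 - t) ^ (a + 1 + (i : ℕ)) =
        (1 - t) ^ (a + M + 1) := fun i => by
      rw [← pow_add]
      congr 1
      omega
    simp [this]
  rw [← e3]
  ring

theorem backwardDet_mul_jacobiHankel_one (M a l : ℕ) (t : ℝ) :
    backwardDet M l t (fun _ => a + M + 1) 0 * jacobiHankel (M + 1) a l 1 =
      jacobiHankel (M + 1) a l (1 - t) := by
  obtain ⟨c, K, hc, h⟩ := exists_mul_jacobiHankel_eq M a l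
  have h0 := h 0
  rw [backwardDet_zero_parameter, sub_zero, mul_one] at h0
  refine mul_left_cancel₀ hc ?_
  rw [h t, ← h0]
  ring

end Hankel

/-! ### The Jacobi ensemble and its Hankel determinants -/

section Jacobi

open MeasureTheory

/-- **Andréief's identity.** -/
theorem integral_det_mul_det {N : ℕ} (μ : Measure ℝ) [SigmaFinite μ] (f g : Fin N → ℝ → ℝ)
    (h : ∀ i j, Integrable (fun x => f i x * g j x) μ) :
    ∫ x : Fin N → ℝ, (Matrix.of fun i j => f i (x j)).det * (Matrix.of fun i j => g i (x j)).det
        ∂(Measure.pi fun _ => μ) =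
      N.factorial * (Matrix.of fun i j => ∫ x, f i x * g j x ∂μ).det := by
  have e : ∀ x : Fin N → ℝ,
      (Matrix.of fun i j => f i (x j)).det * (Matrix.of fun i j => g i (x j)).det =
      ∑ τ : Equiv.Perm (Fin N), ∑ σ : Equiv.Perm (Fin N),
        ((Equiv.Perm.sign σ : ℝ) * (Equiv.Perm.sign τ : ℝ)) *
          ∏ j, (f (σ j) (x j) * g (τ j) (x j)) := by
    intro x
    rw [Matrix.det_apply', Matrix.det_apply', Finset.sum_mul_sum, Finset.sum_comm]
    refine Finset.sum_congr rfl fun τ _ => Finset.sum_congr rfl fun σ _ => ?_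
    rw [Finset.prod_mul_distrib]
    simp only [Matrix.of_apply]
    ring
  simp_rw [e]
  have hint : ∀ σ τ : Equiv.Perm (Fin N), Integrable (fun x : Fin N → ℝ =>
      ((Equiv.Perm.sign σ : ℝ) * (Equiv.Perm.sign τ : ℝ)) *
        ∏ j, (f (σ j) (x j) * g (τ j) (x j))) (Measure.pi fun _ => μ) := fun σ τ =>
    (Integrable.fintype_prod (f := fun j x => f (σ j) x * g (τ j) x)
      fun j => h (σ j) (τ j)).const_mul _
  rw [integral_finsetSum _ fun τ _ => integrable_finsetSum _ fun σ _ => hint σ τ]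
  have hτ : ∀ τ : Equiv.Perm (Fin N), ∫ x : Fin N → ℝ, ∑ σ : Equiv.Perm (Fin N),
      ((Equiv.Perm.sign σ : ℝ) * (Equiv.Perm.sign τ : ℝ)) *
        ∏ j, (f (σ j) (x j) * g (τ j) (x j)) ∂(Measure.pi fun _ => μ) =
      (Matrix.of fun i j => ∫ x, f i x * g j x ∂μ).det := by
    intro τ
    have h1 := Matrix.det_permute' τ (Matrix.of fun i j => ∫ x, f i x * g j x ∂μ)
    have h2 : ((Equiv.Perm.sign τ : ℤ) : ℝ) * ((Equiv.Perm.sign τ : ℤ) : ℝ) = 1 := by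
      rw [← Int.cast_mul, ← Units.val_mul, Int.units_mul_self]
      simp
    rw [integral_finsetSum _ fun σ _ => hint σ τ, ← one_mul (Matrix.det _), ← h2, mul_assoc,
      ← h1, Matrix.det_apply', Finset.mul_sum]
    refine Finset.sum_congr rfl fun σ _ => ?_
    rw [integral_const_mul, integral_fintype_prod_eq_prod (fun j x => f (σ j) x * g (τ j) x)]
    simp only [Matrix.submatrix_apply, Matrix.of_apply, id]
    ring
  simp_rw [hτ]
  simp [Fintype.card_perm]

theorem integral_jueWeight (N a l : ℕ) {ε : ℝ} (h0 : 0 ≤ ε) :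
    ∫ x in Set.Icc (0 : Fin N → ℝ) (fun _ => ε), jueWeight N a l x =
      N.factorial * jacobiHankel N a l ε := by
  have hw : ∀ x : Fin N → ℝ, jueWeight N a l x =
      (Matrix.of fun i j : Fin N => x j ^ (i : ℕ)).det *
        (Matrix.of fun i j : Fin N => x j ^ (i : ℕ) * (x j ^ a * (1 - x j) ^ l)).det := by
    intro x
    have h1 : (Matrix.of fun i j : Fin N => x j ^ (i : ℕ)).det =
        ∏ i : Fin N, ∏ j ∈ Finset.Ioi i, (x j - x i) := by
      rw [← Matrix.det_vandermonde, ← Matrix.det_transpose (Matrix.vandermonde x)]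
      rfl
    have h2 := det_of_mul_mul (fun _ => 1) (fun j : Fin N => x j ^ a * (1 - x j) ^ l)
      (fun i j : Fin N => x j ^ (i : ℕ))
    simp only [one_mul, Finset.prod_const_one, mul_comm (_ * _) (_ ^ _)] at h2
    rw [h2, h1, jueWeight]
    simp only [Real.rpow_natCast, Finset.prod_pow]
    ring
  have hvol : (volume.restrict (Set.Icc (0 : Fin N → ℝ) fun _ => ε)) =
      Measure.pi fun _ => volume.restrict (Set.Icc 0 ε) := by
    rw [← Measure.restrict_pi_pi, Set.pi_univ_Icc]
    rfl
  simp_rw [hw]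
  rw [hvol, integral_det_mul_det _ (fun i y => y ^ (i : ℕ))
    (fun j y => y ^ (j : ℕ) * (y ^ a * (1 - y) ^ l))]
  · unfold jacobiHankel
    congr 2
    ext i j
    simp only [Matrix.of_apply]
    rw [intervalIntegral.integral_of_le h0, integral_Icc_eq_integral_Ioc]
    simp only [mul_assoc]
  · exact fun i j => (Continuous.continuousOn (by fun_prop)).integrableOn_compact isCompact_Icc

theorem jueMeasure_largestParticle_le (M a l : ℕ) {ε : ℝ} (h0 : 0 ≤ ε) (h1 : ε ≤ 1) :
    jueMeasure (M + 1) a l {x | largestParticle x ≤ ε} =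
      ENNReal.ofReal (jacobiHankel (M + 1) a l ε / jacobiHankel (M + 1) a l 1) := by
  have hset : {x : Fin (M + 1) → ℝ | largestParticle x ≤ ε} = Set.Iic fun _ => ε := by
    ext x
    exact ciSup_le_iff (Set.finite_range x).bddAbove
  have hinter : (Set.Iic fun _ => ε) ∩ Set.Icc (0 : Fin (M + 1) → ℝ) 1 =
      Set.Icc 0 fun _ => ε := by
    ext x
    simp only [Set.mem_inter_iff, Set.mem_Iic, Set.mem_Icc]
    exact ⟨fun h => ⟨h.2.1, h.1⟩, fun h => ⟨h.2, h.1, fun j => (h.2 j).trans h1⟩⟩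
  have hsub : Set.Icc (0 : Fin (M + 1) → ℝ) (fun _ => ε) ⊆ Set.Icc 0 1 :=
    Set.Icc_subset_Icc_right fun _ => h1
  have ha : (-1 : ℝ) < a := by linarith [(Nat.cast_nonneg a : (0 : ℝ) ≤ a)]
  have hl : (-1 : ℝ) < l := by linarith [(Nat.cast_nonneg l : (0 : ℝ) ≤ l)]
  have hZ := jueZ_pos (M + 1) ha hl
  have hZe : jueZ (M + 1) a l = (M + 1).factorial * jacobiHankel (M + 1) a l 1 :=
    integral_jueWeight (M + 1) a l zero_le_one
  rw [hset, jueMeasure, withDensity_apply _ measurableSet_Iic,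
    Measure.restrict_restrict measurableSet_Iic, hinter,
    ← ofReal_integral_eq_lintegral_ofReal
      (((integrableOn_jueWeight (M + 1) ha hl).mono_set hsub).div_const _)
      ((ae_restrict_mem measurableSet_Icc).mono fun x hx =>
        div_nonneg (jueWeight_nonneg (hsub hx)) hZ.le),
    integral_div, integral_jueWeight _ _ _ h0, hZe, mul_div_mul_left _ _ (by positivity)]

theorem jacobiHankel_one_ne_zero (N a l : ℕ) : jacobiHankel N a l 1 ≠ 0 := by
  have ha : (-1 : ℝ) < a := by linarith [(Nat.cast_nonneg a : (0 : ℝ) ≤ a)]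
  have hl : (-1 : ℝ) < l := by linarith [(Nat.cast_nonneg l : (0 : ℝ) ≤ l)]
  have hZ := jueZ_pos N ha hl
  have hZe : jueZ N a l = N.factorial * jacobiHankel N a l 1 :=
    integral_jueWeight N a l zero_le_one
  rw [hZe] at hZ
  exact right_ne_zero_of_mul hZ.ne'

end Jacobi

theorem theorem2p5 {Ω : Type*} [MeasurableSpace Ω] (P : MeasureTheory.Measure Ω)
    [MeasureTheory.IsProbabilityMeasure P] (q : ℝ) (hq0 : 0 < q) (hq1 : q < 1)
    (w : ℕ+ × ℕ+ → Ω → ℕ) (hmeas : ∀ s, Measurable (w s))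
    (hindep : ProbabilityTheory.iIndepFun w P)
    (hgeom : ∀ (s : ℕ+ × ℕ+) (k : ℕ),
      P {ω | w s ω = k} = ENNReal.ofReal ((1 - q ^ 2) * q ^ (2 * k)))
    (n m : ℕ+) (hmn : m ≤ n) (l : ℕ) :
    P {ω | lastPassageTime (fun s => w s ω) n m ≤ l} =
      jueMeasure (m : ℕ) ((n : ℝ) - (m : ℝ)) (l : ℝ)
        {x | largestParticle x ≤ 1 - q ^ 2} := by
  have ht0 : 0 ≤ q ^ 2 := sq_nonneg q
  have ht1 : q ^ 2 ≤ 1 := pow_le_one₀ hq0.le hq1.le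
  obtain ⟨M, hM⟩ : ∃ M, (m : ℕ) = M + 1 := ⟨m.natPred, m.natPred_add_one.symm⟩
  obtain ⟨a, ha⟩ : ∃ a, (n : ℕ) = a + M + 1 := by
    obtain ⟨a, ha⟩ := Nat.exists_eq_add_of_le (show (m : ℕ) ≤ n from hmn)
    exact ⟨a, by omega⟩
  have hpar : (n : ℝ) - (m : ℝ) = a := by
    rw [ha, hM]
    push_cast
    ring
  rw [measure_lastPassageTime_le ht0 ht1 hmeas hindep
    (fun s k => by rw [hgeom, pow_mul]) n m hM l, hpar, hM,
    jueMeasure_largestParticle_le M a l (sub_nonneg.2 ht1) (by linarith),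
    ← backwardDet_mul_jacobiHankel_one, ha,
    mul_div_cancel_right₀ _ (jacobiHankel_one_ne_zero (M + 1) a l)]
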